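/- Let $\Gamma$ be a simplicial graph (no loops; possibly infinite) with vertex set $\Lambda$. For each $I\in\Lambda$ let $G_I$ be a group and $P_I\subseteq G_I$ a submonoid such that $(G_I,P_I)$ is quasi-lattice ordered. Here, for a submonoid $P$ of a group $G$, write $x\le y$ iff $x^{-1}y\in P$; $(G,P)$ is quasi-lattice ordered if $P\cap P^{-1}=\{1\}$ and any two elements $x,y\in G$ with a common upper bound in $G$ have a least upper bound $x\vee y$ in $G$. If $x,y$ have no common upper bound, write $x\vee y=\infty$. Let $G$ be the graph product of the $G_I$ over $\Gamma$, i.e. the quotient of the free product of the $G_I$ by the normal closure of the commutators $aba^{-1}b^{-1}$ with $a\in G_I$, $b\in G_J$ and $I,J$ adjacent in $\Gamma$. Let $P$ be the submonoid of $G$ generated by all the $P_I$, and order $G$ by the cone $P$. An expression for $x\in G$ is a word $x_1\cdots x_\ell$ representing $x$, whose syllables $x_i$ are nontrivial elements of the groups $G_{I(x_i)}$. It is reduced if no word obtained from it by repeatedly swapping neighbouring syllables that belong to adjacent vertices contains two neighbouring syllables belonging to the same vertex. The vertices of $x$ are the vertices $I(x_i)$ of the syllables of a reduced expression for $x$, and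 the length $\ell(x)$ is the length of a reduced expression for $x$. A syllable $x_i$ of a reduced expression is initial if $I(x_i)$ is adjacent to $I(x_j)$ for all $j<i$; the vertices of the initial syllables form the set $\Delta(x)$ of initial vertices of $x$. For $I\in\Lambda$, let $x_I\in G_I$ be the initial syllable belonging to $I$ if $I\in\Delta(x)$, and $x_I=1$ otherwise; write $x=x_Ix'$. (These notions do not depend on the reduced expression chosen.) For $I\in\Lambda$, elements $x=x_Ix'$ and $y=y_Iy'$ of $P$ are called $I$-adjacent if (a) $x_I\vee y_I\neq\infty$ in $(G_I,P_I)$; (b) either $x_I=x_I\vee y_I$ or $I$ is adjacent to every vertex of $x'$; (c) either $y_I=x_I\vee y_I$ or $I$ is adjacent to every vertex of $y'$. **Proposition.** Let $x,y\in P$, let $I\in\Lambda$, and write $x=x_Ix'$, $y=y_Iy'$. (i) $x$ and $y$ have a common upper bound in $G$ if and only if they are $I$-adjacent and $x'\vee y'\neq\infty$. (ii) If $x$ and $y$ have a common upper bound, then the least upper bounds $x_I\vee y_I$ (in $G_I$), $x'\vee y'$ and $x\vee y$ (in $G$) exist, $x \vee y$ is unique, and $$x\vee y=(x_I\vee y_I)(x'\vee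 y').$$ (iii) These rules form a terminating inductive procedure that decides whether $x\vee y\ne\infty$ and expresses $x\vee y$ through joins in the vertex groups: $x',y'\in P$; if $I\in\Delta(x)\cup\Delta(y)$ then $\ell(x')+\ell(y')<\ell(x)+\ell(y)$; and $\Delta(x)\cup\Delta(y)\neq\emptyset$ unless $x=y=1$. -/

import Mathlib

namespace QLGraph

/-! ### Partially ordered groups given by a positive cone -/

section Order

variable {H : Type*} [Group H]

/-- The left-invariant relation `x ≤ y` iff `x⁻¹ y ∈ P`. -/
def ConeLE (P : Submonoid H) (x y : H) : Prop := x⁻¹ * y ∈ P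

/-- `z` is a common upper bound of `x` and `y`. -/
def IsUpper (P : Submonoid H) (x y z : H) : Prop := ConeLE P x z ∧ ConeLE P y z

/-- `x` and `y` have a common upper bound in the group, that is, `x ∨ y ≠ ∞`. -/
def Bounded (P : Submonoid H) (x y : H) : Prop := ∃ z, IsUpper P x y z

/-- `z` is a least upper bound of `x` and `y`, that is, `z = x ∨ y`. -/
def IsJoin (P : Submonoid H) (x y z : H) : Prop :=
  IsUpper P x y z ∧ ∀ w, IsUpper P x y w → ConeLE P z w

/-- `(H, P)` is quasi-lattice ordered: `P ∩ P⁻¹ = {1}`, and every pair of elements with a common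
upper bound in `H` has a least upper bound in `H`. -/
structure IsQuasiLattice (P : Submonoid H) : Prop where
  pointed : ∀ x, x ∈ P → x⁻¹ ∈ P → x = 1
  exists_join : ∀ x y, Bounded P x y → ∃ z, IsJoin P x y z

end Order

/-! ### Graph products of groups -/

variable {Λ : Type*} (Γ : SimpleGraph Λ) (G : Λ → Type*) [∀ I, Group (G I)]

/-- The commutators of elements of vertex groups at adjacent vertices, in the free product. -/
def relators : Set (Monoid.CoprodI G) :=
  {r | ∃ (I J : Λ) (x : G I) (y : G J), Γ.Adj I J ∧
    r = Monoid.CoprodI.of x * Monoid.CoprodI.of y *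
      (Monoid.CoprodI.of x)⁻¹ * (Monoid.CoprodI.of y)⁻¹}

/-- The graph product of the groups `G I` over `Γ`. -/
abbrev GraphProduct : Type _ :=
  Monoid.CoprodI G ⧸ Subgroup.normalClosure (relators Γ G)

variable {G}

/-- The canonical map of a vertex group into the graph product. -/
def incl (I : Λ) : G I →* GraphProduct Γ G :=
  (QuotientGroup.mk' (Subgroup.normalClosure (relators Γ G))).comp Monoid.CoprodI.of

/-- The submonoid of the graph product generated by the cones `P I`. -/
def cone (P : ∀ I, Submonoid (G I)) : Submonoid (GraphProduct Γ G) :=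
  ⨆ I, (P I).map (incl Γ I)

/-! ### Expressions -/

variable (G) in
/-- The generators: the disjoint union of the sets `G I \ {1}`. -/
abbrev Gen : Type _ := {s : Σ I, G I // s.2 ≠ 1}

/-- The vertex to which a generator belongs. -/
def Gen.vertex (s : Gen G) : Λ := s.1.1

/-- The element of the graph product represented by an expression. -/
def value (X : List (Gen G)) : GraphProduct Γ G :=
  (X.map fun s => incl Γ s.1.1 s.1.2).prod

/-- A single shuffle. -/
inductive Shuffle : List (Gen G) → List (Gen G) → Prop
  | swap (A B : List (Gen G)) (s t : Gen G) (h : Γ.Adj s.vertex t.vertex) :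
      Shuffle (A ++ s :: t :: B) (A ++ t :: s :: B)

/-- Shuffle equivalence (a single shuffle is reversible). -/
def ShuffleEquiv (X Y : List (Gen G)) : Prop := Relation.ReflTransGen (Shuffle Γ) X Y

/-- Two consecutive syllables belong to the same vertex. -/
def AdmitsAmalgamation (X : List (Gen G)) : Prop :=
  ∃ (A B : List (Gen G)) (s t : Gen G), X = A ++ s :: t :: B ∧ s.vertex = t.vertex

/-- Reduced expressions. -/
def IsReduced (X : List (Gen G)) : Prop := ∀ Y, ShuffleEquiv Γ X Y → ¬ AdmitsAmalgamation Y

/-- `X` is a reduced expression for `x`. -/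
def IsReducedFor (X : List (Gen G)) (x : GraphProduct Γ G) : Prop :=
  IsReduced Γ X ∧ value Γ X = x

/-- `s` is an initial syllable of `X`. -/
def IsInitialSyllable (X : List (Gen G)) (s : Gen G) : Prop :=
  ∃ A B : List (Gen G), X = A ++ s :: B ∧ ∀ t ∈ A, Γ.Adj s.vertex t.vertex

/-- The length of an element: the length of a reduced expression for it. -/
noncomputable def len (x : GraphProduct Γ G) : ℕ :=
  sInf {n | ∃ X : List (Gen G), IsReducedFor Γ X x ∧ X.length = n}

/-- The vertices of an element: those of its reduced expressions. -/
def vertices (x : GraphProduct Γ G) : Set Λ :=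
  {I | ∃ X : List (Gen G), IsReducedFor Γ X x ∧ ∃ s ∈ X, s.vertex = I}

/-- The set `Δ(x)` of initial vertices of an element. -/
def initialVertices (x : GraphProduct Γ G) : Set Λ :=
  {I | ∃ X : List (Gen G), IsReducedFor Γ X x ∧ ∃ s, IsInitialSyllable Γ X s ∧ s.vertex = I}

/-- `g` is the component `x_I`, computed from some reduced expression for `x`: the initial syllable
belonging to `I` if there is one, and `1` otherwise. -/
def IsComponent (I : Λ) (x : GraphProduct Γ G) (g : G I) : Prop :=
  ∃ X : List (Gen G), IsReducedFor Γ X x ∧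
    ((∃ h : g ≠ 1, IsInitialSyllable Γ X ⟨⟨I, g⟩, h⟩) ∨
      (g = 1 ∧ ∀ s, IsInitialSyllable Γ X s → s.vertex ≠ I))

/-- The decomposition `x = x_I x'`. -/
def IsDecomposition (I : Λ) (x : GraphProduct Γ G) (xI : G I) (x' : GraphProduct Γ G) : Prop :=
  IsComponent Γ I x xI ∧ x = incl Γ I xI * x'

/-- `I`-adjacency of two elements `x = x_I x'` and `y = y_I y'`. -/
structure IAdjacent (P : ∀ I, Submonoid (G I)) (I : Λ)
    (xI : G I) (x' : GraphProduct Γ G) (yI : G I) (y' : GraphProduct Γ G) : Prop where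
  bounded : Bounded (P I) xI yI
  left : IsJoin (P I) xI yI xI ∨ ∀ J ∈ vertices Γ x', Γ.Adj I J
  right : IsJoin (P I) xI yI yI ∨ ∀ J ∈ vertices Γ y', Γ.Adj I J

/-! ### Reduced expressions and the decompositions `x = x_I x'` exist -/

lemma incl_comm {I J : Λ} (h : Γ.Adj I J) (a : G I) (b : G J) :
    incl Γ I a * incl Γ J b = incl Γ J b * incl Γ I a := by
  have : (QuotientGroup.mk' (Subgroup.normalClosure (relators Γ G)))
     (Monoid.CoprodI.of a * Monoid.CoprodI.of b *
      (Monoid.CoprodI.of a)⁻¹ * (Monoid.CoprodI.of b)⁻¹) = 1 := by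
    rw [← MonoidHom.mem_ker, QuotientGroup.ker_mk']
    exact Subgroup.subset_normalClosure ⟨I, J, a, b, h, rfl⟩
  simp only [map_mul, map_inv] at this
  change incl Γ I a * incl Γ J b * (incl Γ I a)⁻¹ * (incl Γ J b)⁻¹ = 1 at this
  rw [mul_inv_eq_one, mul_inv_eq_iff_eq_mul] at this
  exact this

lemma shuffle_value {X Y : List (Gen G)} (h : ShuffleEquiv Γ X Y) :
    value Γ X = value Γ Y ∧ X.length = Y.length := by
  induction h with
  | refl => simp
  | tail _ h ih =>
    obtain ⟨A, B, s, t, h⟩ := h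
    refine ⟨ih.1.trans ?_, ih.2.trans (by simp)⟩
    simp only [value, List.map_append, List.prod_append, List.map_cons, List.prod_cons]
    rw [← mul_assoc (incl Γ s.1.1 s.1.2),
      incl_comm Γ (I := s.1.1) (J := t.1.1) h]
    simp [mul_assoc]

lemma amalg {X : List (Gen G)} (h : AdmitsAmalgamation X) :
    ∃ Y : List (Gen G), value Γ Y = value Γ X ∧ Y.length < X.length := by
  obtain ⟨A, B, ⟨⟨I, a⟩, ha⟩, ⟨⟨J, b⟩, hb⟩, rfl, h⟩ := h
  change I = J at h
  subst h
  by_cases hab : a * b = 1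
  · refine ⟨A ++ B, ?_, by simp⟩
    simp [value, ← mul_assoc (incl Γ I a), ← map_mul, hab]
  · refine ⟨A ++ ⟨⟨I, a * b⟩, hab⟩ :: B, ?_, by simp⟩
    simp [value, mul_assoc]

lemma exists_expr (x : GraphProduct Γ G) : ∃ X : List (Gen G), value Γ X = x := by
  obtain ⟨w, rfl⟩ := QuotientGroup.mk'_surjective _ x
  induction w using Monoid.CoprodI.induction_on with
  | one => exact ⟨[], by simp [value]⟩
  | of I a =>
    by_cases h : a = 1
    · exact ⟨[], by simp [value, h]⟩
    · exact ⟨[⟨⟨I, a⟩, h⟩], by simp [value, incl]⟩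
  | mul u v hu hv =>
    obtain ⟨X, hX⟩ := hu
    obtain ⟨Y, hY⟩ := hv
    exact ⟨X ++ Y, by rw [map_mul, ← hX, ← hY]; simp [value]⟩

lemma exists_reduced (x : GraphProduct Γ G) : ∃ X : List (Gen G), IsReducedFor Γ X x := by
  have hne : ∃ n, ∃ X : List (Gen G), value Γ X = x ∧ X.length = n := by
    obtain ⟨X, hX⟩ := exists_expr Γ x
    exact ⟨_, X, hX, rfl⟩
  classical
  obtain ⟨X, hX, hn⟩ := Nat.find_spec hne
  refine ⟨X, fun Y hY ha => ?_, hX⟩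
  obtain ⟨h1, h2⟩ := shuffle_value Γ hY
  obtain ⟨Z, hZ, hl⟩ := amalg Γ ha
  exact Nat.find_min hne (m := Z.length) (by omega) ⟨Z, by rw [hZ, ← h1, hX], rfl⟩

lemma exists_decomposition (I : Λ) (x : GraphProduct Γ G) :
    ∃ xI x', IsDecomposition Γ I x xI x' := by
  obtain ⟨X, hX⟩ := exists_reduced Γ x
  by_cases h : ∃ s, IsInitialSyllable Γ X s ∧ s.vertex = I
  · obtain ⟨⟨⟨J, a⟩, ha⟩, hs, rfl⟩ := h
    exact ⟨a, (incl Γ _ a)⁻¹ * x, ⟨X, hX, Or.inl ⟨ha, hs⟩⟩, (mul_inv_cancel_left _ _).symm⟩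
  · push Not at h
    exact ⟨1, x, ⟨X, hX, Or.inr ⟨rfl, h⟩⟩, by simp⟩
end QLGraph

/-! The normal form theorem comes from an action. Each vertex group acts on reduced words modulo
shuffling by multiplying the initial syllable at its vertex. Actions at adjacent vertices commute
(`Word.vertexAct_comm`), so the graph product acts, and the orbit of the empty word recovers every
reduced expression up to shuffling (`toWord_value`). Hence x_I and x' are functions of x. The cone
preserves words with positive syllables, so reduced expressions of elements of P are positive.

The crux is that positive syllables never cancel. If z = xw with x, w in P, then z_I = x_I (x'w)_I.
A nontrivial second factor must have moved past all of x', so I is adjacent to every vertex of x'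
(`vertices_adj_of_component_mul_ne_one`). In either case x' ≤ z' (`coneLE_component_rest`), so upper
bounds split into upper bounds at I and upper bounds of the rests; `isUpper_incl_mul` reassembles
them.

For leastness of ab, with a = x_I ∨ y_I and b = x' ∨ y', write z_I = ap. If p ≠ 1, then I is
adjacent to all vertices of x' and y', hence to those of b (`vertices_subset_of_isJoin`), and p
moves past b (`isJoin_incl_mul`). Joins exist by induction on total length (`cone_exists_isJoin`).
-/

namespace QLGraph

/-! ### Initial syllables of expressions -/

section Words

variable {Λ : Type*} (Γ : SimpleGraph Λ) {G : Λ → Type*} [∀ I, Group (G I)]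

open Classical in
/-- The initial syllable of `X` at the vertex `I`, or `1` if there is none. -/
noncomputable def syllHead (I : Λ) : List (Gen G) → G I
  | [] => 1
  | s :: X => if h : s.1.1 = I then h ▸ s.1.2 else if Γ.Adj I s.1.1 then syllHead I X else 1

open Classical in
/-- The expression `X` with its initial syllable at the vertex `I` removed. -/
noncomputable def syllTail (I : Λ) : List (Gen G) → List (Gen G)
  | [] => []
  | s :: X => if s.1.1 = I then X else if Γ.Adj I s.1.1 then s :: syllTail I X else s :: X

open Classical in
/-- Prepend a possibly trivial element of a vertex group to an expression. -/
noncomputable def syllCons {I : Λ} (g : G I) (X : List (Gen G)) : List (Gen G) :=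
  if h : g ≠ 1 then ⟨⟨I, g⟩, h⟩ :: X else X

/-- A recursive form of reducedness. -/
def RecReduced : List (Gen G) → Prop
  | [] => True
  | s :: X => syllHead Γ s.1.1 X = 1 ∧ RecReduced X

@[simp] lemma syllCons_one (I : Λ) (X : List (Gen G)) : syllCons (1 : G I) X = X := by
  simp [syllCons]

lemma syllCons_of_ne {I : Λ} {g : G I} (h : g ≠ 1) (X : List (Gen G)) :
    syllCons g X = ⟨⟨I, g⟩, h⟩ :: X := by simp [syllCons, h]

@[simp] lemma syllHead_nil (I : Λ) : syllHead Γ I ([] : List (Gen G)) = 1 := rfl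

lemma syllHead_cons_same {I : Λ} {g : G I} (h : g ≠ 1) (X : List (Gen G)) :
    syllHead Γ I (⟨⟨I, g⟩, h⟩ :: X) = g := by simp [syllHead]

lemma syllHead_cons_self (s : Gen G) (X : List (Gen G)) :
    syllHead Γ s.1.1 (s :: X) = s.1.2 := by simp [syllHead]

lemma syllTail_cons_self (s : Gen G) (X : List (Gen G)) :
    syllTail Γ s.1.1 (s :: X) = X := by simp [syllTail]

lemma syllHead_cons_adj {I : Λ} {s : Gen G} (h : Γ.Adj I s.1.1) (X : List (Gen G)) :
    syllHead Γ I (s :: X) = syllHead Γ I X := by simp [syllHead, h, h.ne']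

lemma syllTail_cons_adj {I : Λ} {s : Gen G} (h : Γ.Adj I s.1.1) (X : List (Gen G)) :
    syllTail Γ I (s :: X) = s :: syllTail Γ I X := by simp [syllTail, h, h.ne']

lemma syllHead_cons_of_not_adj {I : Λ} {s : Gen G} (h : ¬ Γ.Adj I s.1.1) (hne : s.1.1 ≠ I)
    (X : List (Gen G)) : syllHead Γ I (s :: X) = 1 := by simp [syllHead, h, hne]

lemma syllTail_cons_of_not_adj {I : Λ} {s : Gen G} (h : ¬ Γ.Adj I s.1.1) (hne : s.1.1 ≠ I)
    (X : List (Gen G)) : syllTail Γ I (s :: X) = s :: X := by simp [syllTail, h, hne]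

lemma syllTail_eq_self {I : Λ} {X : List (Gen G)} (h : syllHead Γ I X = 1) :
    syllTail Γ I X = X := by
  induction X with
  | nil => rfl
  | cons s X ih =>
    by_cases hs : s.1.1 = I
    · subst hs
      rw [syllHead_cons_self] at h
      exact absurd h s.2
    · by_cases ha : Γ.Adj I s.1.1
      · rw [syllHead_cons_adj Γ ha] at h
        rw [syllTail_cons_adj Γ ha, ih h]
      · exact syllTail_cons_of_not_adj Γ ha hs X

lemma syllHead_syllCons_same {I : Λ} (g : G I) {X : List (Gen G)} (h : syllHead Γ I X = 1) :
    syllHead Γ I (syllCons g X) = g := by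
  by_cases hg : g = 1
  · simp [hg, h]
  · rw [syllCons_of_ne hg, syllHead_cons_same]

lemma syllTail_syllCons_same {I : Λ} (g : G I) {X : List (Gen G)} (h : syllHead Γ I X = 1) :
    syllTail Γ I (syllCons g X) = X := by
  by_cases hg : g = 1
  · simp [hg, syllTail_eq_self Γ h]
  · rw [syllCons_of_ne hg]
    exact syllTail_cons_self Γ ⟨⟨I, g⟩, hg⟩ X

lemma syllHead_syllCons_adj {I J : Λ} (hIJ : Γ.Adj I J) (g : G J) (X : List (Gen G)) :
    syllHead Γ I (syllCons g X) = syllHead Γ I X := by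
  by_cases hg : g = 1
  · simp [hg]
  · rw [syllCons_of_ne hg, syllHead_cons_adj Γ hIJ]

lemma syllTail_syllCons_adj {I J : Λ} (hIJ : Γ.Adj I J) (g : G J) (X : List (Gen G)) :
    syllTail Γ I (syllCons g X) = syllCons g (syllTail Γ I X) := by
  by_cases hg : g = 1
  · simp [hg]
  · rw [syllCons_of_ne hg, syllCons_of_ne hg, syllTail_cons_adj Γ hIJ]

lemma Shuffle.cons (s : Gen G) {X Y : List (Gen G)} (h : Shuffle Γ X Y) :
    Shuffle Γ (s :: X) (s :: Y) := by
  obtain ⟨A, B, a, b, hab⟩ := h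
  exact Shuffle.swap (s :: A) B a b hab

lemma ShuffleEquiv.cons (s : Gen G) {X Y : List (Gen G)} (h : ShuffleEquiv Γ X Y) :
    ShuffleEquiv Γ (s :: X) (s :: Y) := by
  induction h with
  | refl => exact Relation.ReflTransGen.refl
  | tail _ h ih => exact ih.tail (h.cons Γ s)

lemma shuffleEquiv_swap {s t : Gen G} (h : Γ.Adj s.1.1 t.1.1) (X : List (Gen G)) :
    ShuffleEquiv Γ (s :: t :: X) (t :: s :: X) :=
  Relation.ReflTransGen.single (Shuffle.swap [] X s t h)

lemma shuffleEquiv_syllCons (I : Λ) (X : List (Gen G)) :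
    ShuffleEquiv Γ X (syllCons (syllHead Γ I X) (syllTail Γ I X)) := by
  induction X with
  | nil =>
    rw [syllHead_nil, syllCons_one]
    exact Relation.ReflTransGen.refl
  | cons s X ih =>
    by_cases hs : s.1.1 = I
    · subst hs
      rw [syllHead_cons_self, syllTail_cons_self, syllCons_of_ne s.2]
      exact Relation.ReflTransGen.refl
    · by_cases ha : Γ.Adj I s.1.1
      · rw [syllHead_cons_adj Γ ha, syllTail_cons_adj Γ ha]
        refine (ih.cons Γ s).trans ?_
        by_cases h1 : syllHead Γ I X = 1
        · rw [h1, syllCons_one, syllCons_one]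
        · rw [syllCons_of_ne h1, syllCons_of_ne h1]
          exact shuffleEquiv_swap Γ ha.symm _
      · rw [syllHead_cons_of_not_adj Γ ha hs, syllTail_cons_of_not_adj Γ ha hs, syllCons_one]
        exact Relation.ReflTransGen.refl

/-- Of the two initial syllables, the later one has to be shuffled past the earlier one. -/
lemma adj_of_syllHead_ne_one {I J : Λ} (hIJ : I ≠ J) {X : List (Gen G)}
    (hI : syllHead Γ I X ≠ 1) (hJ : syllHead Γ J X ≠ 1) : Γ.Adj I J := by
  induction X with
  | nil => exact absurd rfl hI
  | cons s X ih =>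
    by_cases hsI : s.1.1 = I
    · subst hsI
      by_contra h
      exact hJ (syllHead_cons_of_not_adj Γ (fun h' => h h'.symm) hIJ X)
    · by_cases hsJ : s.1.1 = J
      · subst hsJ
        by_contra h
        exact hI (syllHead_cons_of_not_adj Γ h hsI X)
      · by_cases haI : Γ.Adj I s.1.1
        · by_cases haJ : Γ.Adj J s.1.1
          · rw [syllHead_cons_adj Γ haI] at hI
            rw [syllHead_cons_adj Γ haJ] at hJ
            exact ih hI hJ
          · exact absurd (syllHead_cons_of_not_adj Γ haJ hsJ X) hJ
        · exact absurd (syllHead_cons_of_not_adj Γ haI hsI X) hI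

/-! ### Expressions modulo shuffling -/

variable (G) in
/-- Expressions up to shuffling. -/
def Word : Type _ := Quot (Shuffle Γ (G := G))

/-- The class of an expression. -/
def Word.mk (X : List (Gen G)) : Word Γ G := Quot.mk _ X

lemma Word.mk_eq_of_shuffleEquiv {X Y : List (Gen G)} (h : ShuffleEquiv Γ X Y) :
    Word.mk Γ X = Word.mk Γ Y := by
  induction h with
  | refl => rfl
  | tail _ h ih => exact ih.trans (Quot.sound h)

lemma syllHead_eq_of_shuffle (I : Λ) {X Y : List (Gen G)} (h : Shuffle Γ X Y) :
    syllHead Γ I X = syllHead Γ I Y := by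
  obtain ⟨A, B, s, t, hst⟩ := h
  induction A with
  | nil =>
    have hst' : Γ.Adj s.1.1 t.1.1 := hst
    simp only [List.nil_append]
    by_cases hs : s.1.1 = I
    · subst hs
      rw [syllHead_cons_adj Γ hst', syllHead_cons_self, syllHead_cons_self]
    by_cases ht : t.1.1 = I
    · subst ht
      rw [syllHead_cons_adj Γ hst'.symm, syllHead_cons_self, syllHead_cons_self]
    simp only [syllHead, hs, ht, dif_neg, not_false_eq_true]
    split_ifs <;> rfl
  | cons a A ih => simp only [List.cons_append, syllHead, ih]

lemma Word.mk_syllTail_eq_of_shuffle (I : Λ) {X Y : List (Gen G)} (h : Shuffle Γ X Y) :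
    Word.mk Γ (syllTail Γ I X) = Word.mk Γ (syllTail Γ I Y) := by
  apply Word.mk_eq_of_shuffleEquiv
  obtain ⟨A, B, s, t, hst⟩ := h
  have hst' : Γ.Adj s.1.1 t.1.1 := hst
  induction A with
  | nil =>
    simp only [List.nil_append]
    by_cases hs : s.1.1 = I
    · subst hs
      rw [syllTail_cons_adj Γ hst', syllTail_cons_self, syllTail_cons_self]
      exact Relation.ReflTransGen.refl
    by_cases ht : t.1.1 = I
    · subst ht
      rw [syllTail_cons_adj Γ hst'.symm, syllTail_cons_self, syllTail_cons_self]
      exact Relation.ReflTransGen.refl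
    by_cases has : Γ.Adj I s.1.1 <;> by_cases hat : Γ.Adj I t.1.1 <;>
      simp only [syllTail, hs, ht, has, hat, if_true, if_false] <;>
      exact shuffleEquiv_swap Γ hst' _
  | cons a A ih =>
    simp only [List.cons_append, syllTail]
    split_ifs
    · exact Relation.ReflTransGen.single (Shuffle.swap A B s t hst)
    · exact ih.cons Γ a
    · exact Relation.ReflTransGen.single (Shuffle.swap (a :: A) B s t hst)

lemma recReduced_of_shuffle {X Y : List (Gen G)} (h : Shuffle Γ X Y) :
    RecReduced Γ X ↔ RecReduced Γ Y := by
  obtain ⟨A, B, s, t, hst⟩ := h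
  have hst' : Γ.Adj s.1.1 t.1.1 := hst
  induction A with
  | nil =>
    simp only [List.nil_append, RecReduced, syllHead_cons_adj Γ hst',
      syllHead_cons_adj Γ hst'.symm]
    tauto
  | cons a A ih =>
    simp only [List.cons_append, RecReduced, ih,
      syllHead_eq_of_shuffle Γ _ (Shuffle.swap A B s t hst)]

namespace Word

/-- The initial syllable of a word at a vertex. -/
noncomputable def head (I : Λ) : Word Γ G → G I :=
  Quot.lift (syllHead Γ I) fun _ _ h => syllHead_eq_of_shuffle Γ I h

/-- A word with its initial syllable at a vertex removed. -/
noncomputable def tail (I : Λ) : Word Γ G → Word Γ G :=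
  Quot.lift (fun X => mk Γ (syllTail Γ I X)) fun _ _ h => mk_syllTail_eq_of_shuffle Γ I h

/-- Prepend an element of a vertex group to a word. -/
noncomputable def cons {I : Λ} (g : G I) : Word Γ G → Word Γ G :=
  Quot.lift (fun X => mk Γ (syllCons g X)) fun X Y h => by
    by_cases hg : g = 1
    · subst hg
      simp only [syllCons_one]
      exact Quot.sound h
    · simp only [syllCons_of_ne hg]
      exact Quot.sound (h.cons Γ _)

/-- Reduced words. -/
def Reduced : Word Γ G → Prop :=
  Quot.lift (RecReduced Γ) fun _ _ h => propext (recReduced_of_shuffle Γ h)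

/-- Words all of whose syllables lie in the given submonoids. -/
def Positive (P : ∀ I, Submonoid (G I)) : Word Γ G → Prop :=
  Quot.lift (fun X => ∀ s ∈ X, s.1.2 ∈ P s.1.1) fun _ _ h => by
    obtain ⟨A, B, s, t, hst⟩ := h
    simp only [List.mem_append, List.mem_cons, eq_iff_iff]
    grind

lemma cons_head_tail (I : Λ) (w : Word Γ G) : cons Γ (head Γ I w) (tail Γ I w) = w := by
  induction w using Quot.ind with
  | mk X => exact (mk_eq_of_shuffleEquiv Γ (shuffleEquiv_syllCons Γ I X)).symm

lemma cons_one (I : Λ) (w : Word Γ G) : cons Γ (1 : G I) w = w := by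
  induction w using Quot.ind with
  | mk X => exact congrArg (mk Γ) (syllCons_one I X)

lemma head_cons_same {I : Λ} (g : G I) {w : Word Γ G} (h : head Γ I w = 1) :
    head Γ I (cons Γ g w) = g := by
  induction w using Quot.ind with
  | mk X => exact syllHead_syllCons_same Γ g h

lemma tail_cons_same {I : Λ} (g : G I) {w : Word Γ G} (h : head Γ I w = 1) :
    tail Γ I (cons Γ g w) = w := by
  induction w using Quot.ind with
  | mk X => exact congrArg (mk Γ) (syllTail_syllCons_same Γ g h)

lemma head_cons_adj {I J : Λ} (hIJ : Γ.Adj I J) (g : G J) (w : Word Γ G) :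
    head Γ I (cons Γ g w) = head Γ I w := by
  induction w using Quot.ind with
  | mk X => exact syllHead_syllCons_adj Γ hIJ g X

lemma tail_cons_adj {I J : Λ} (hIJ : Γ.Adj I J) (g : G J) (w : Word Γ G) :
    tail Γ I (cons Γ g w) = cons Γ g (tail Γ I w) := by
  induction w using Quot.ind with
  | mk X => exact congrArg (mk Γ) (syllTail_syllCons_adj Γ hIJ g X)

lemma cons_cons_adj {I J : Λ} (hIJ : Γ.Adj I J) (g : G I) (h : G J) (w : Word Γ G) :
    cons Γ g (cons Γ h w) = cons Γ h (cons Γ g w) := by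
  by_cases hg : g = 1
  · simp [hg, cons_one]
  by_cases hh : h = 1
  · simp [hh, cons_one]
  induction w using Quot.ind with
  | mk X =>
    change mk Γ (syllCons g (syllCons h X)) = mk Γ (syllCons h (syllCons g X))
    simp only [syllCons_of_ne hg, syllCons_of_ne hh]
    exact mk_eq_of_shuffleEquiv Γ (shuffleEquiv_swap Γ hIJ X)

lemma head_tail_adj {I J : Λ} (hIJ : Γ.Adj I J) (w : Word Γ G) :
    head Γ I (tail Γ J w) = head Γ I w := by
  conv_rhs => rw [← cons_head_tail Γ J w]
  rw [head_cons_adj Γ hIJ]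

lemma Reduced.head_tail {w : Word Γ G} (h : Reduced Γ w) (I : Λ) :
    head Γ I (tail Γ I w) = 1 := by
  induction w using Quot.ind with
  | mk X =>
    change RecReduced Γ X at h
    change syllHead Γ I (syllTail Γ I X) = 1
    induction X with
    | nil => rfl
    | cons s X ih =>
      by_cases hs : s.1.1 = I
      · subst hs
        rw [syllTail_cons_self]
        exact h.1
      · by_cases ha : Γ.Adj I s.1.1
        · rw [syllTail_cons_adj Γ ha, syllHead_cons_adj Γ ha, ih h.2]
        · rw [syllTail_cons_of_not_adj Γ ha hs, syllHead_cons_of_not_adj Γ ha hs]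

lemma Reduced.tail {w : Word Γ G} (h : Reduced Γ w) (I : Λ) : Reduced Γ (tail Γ I w) := by
  induction w using Quot.ind with
  | mk X =>
    change RecReduced Γ X at h
    change RecReduced Γ (syllTail Γ I X)
    induction X with
    | nil => trivial
    | cons s X ih =>
      by_cases hs : s.1.1 = I
      · subst hs
        rw [syllTail_cons_self]
        exact h.2
      · by_cases ha : Γ.Adj I s.1.1
        · rw [syllTail_cons_adj Γ ha]
          exact ⟨(head_tail_adj Γ ha.symm (mk Γ X)).trans h.1, ih h.2⟩
        · rwa [syllTail_cons_of_not_adj Γ ha hs]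

lemma Reduced.cons {w : Word Γ G} (h : Reduced Γ w) {I : Λ} (g : G I) (h1 : head Γ I w = 1) :
    Reduced Γ (cons Γ g w) := by
  by_cases hg : g = 1
  · rwa [hg, cons_one]
  · induction w using Quot.ind with
    | mk X =>
      change RecReduced Γ (syllCons g X)
      rw [syllCons_of_ne hg]
      exact ⟨h1, h⟩

variable {P : ∀ I, Submonoid (G I)}

lemma Positive.cons {w : Word Γ G} (h : Positive Γ P w) {I : Λ} {g : G I} (hg : g ∈ P I) :
    Positive Γ P (cons Γ g w) := by
  by_cases h1 : g = 1
  · rwa [h1, cons_one]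
  · induction w using Quot.ind with
    | mk X =>
      change ∀ s ∈ syllCons g X, _
      rw [syllCons_of_ne h1]
      exact List.forall_mem_cons.2 ⟨hg, h⟩

lemma Positive.tail {w : Word Γ G} (h : Positive Γ P w) (I : Λ) :
    Positive Γ P (tail Γ I w) := by
  induction w using Quot.ind with
  | mk X =>
    change ∀ s ∈ X, _ at h
    change ∀ s ∈ syllTail Γ I X, _
    induction X with
    | nil => exact h
    | cons s X ih =>
      rw [List.forall_mem_cons] at h
      simp only [syllTail]
      split_ifs
      · exact h.2
      · exact List.forall_mem_cons.2 ⟨h.1, ih h.2⟩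
      · exact List.forall_mem_cons.2 h

lemma Positive.head {w : Word Γ G} (h : Positive Γ P w) (I : Λ) : head Γ I w ∈ P I := by
  induction w using Quot.ind with
  | mk X =>
    change ∀ s ∈ X, _ at h
    change syllHead Γ I X ∈ P I
    induction X with
    | nil => exact one_mem _
    | cons s X ih =>
      rw [List.forall_mem_cons] at h
      simp only [syllHead]
      split_ifs with h1
      · subst h1
        exact h.1
      · exact ih h.2
      · exact one_mem _

/-! ### The action on reduced words -/

variable (G) in
/-- The reduced words. -/
abbrev Red : Type _ := {w : Word Γ G // Reduced Γ w}

/-- The action of a vertex group on the reduced words. -/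
noncomputable def vertexAct (I : Λ) : G I →* Function.End (Red Γ G) where
  toFun g w := ⟨cons Γ (g * head Γ I w.1) (Word.tail Γ I w.1),
    (w.2.tail Γ I).cons Γ _ (w.2.head_tail Γ I)⟩
  map_one' := by
    funext w
    apply Subtype.ext
    change cons Γ (1 * head Γ I w.1) (Word.tail Γ I w.1) = w.1
    rw [one_mul, cons_head_tail]
  map_mul' g h := by
    funext w
    apply Subtype.ext
    change cons Γ _ _ = cons Γ (g * head Γ I (cons Γ _ _)) (Word.tail Γ I (cons Γ _ _))
    rw [head_cons_same Γ _ (w.2.head_tail Γ I), tail_cons_same Γ _ (w.2.head_tail Γ I), mul_assoc]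

lemma tail_tail_adj {I J : Λ} (hIJ : Γ.Adj I J) {w : Word Γ G} (hw : Reduced Γ w) :
    Word.tail Γ J (Word.tail Γ I w) = Word.tail Γ I (Word.tail Γ J w) := by
  conv_lhs => rw [← cons_head_tail Γ J w, tail_cons_adj Γ hIJ]
  apply tail_cons_same
  rw [head_tail_adj Γ hIJ.symm, hw.head_tail]

/-- Changing the head at one vertex leaves the head at an adjacent vertex untouched. This is the
relation needed for the vertex actions to descend to the graph product. -/
lemma vertexAct_comm {I J : Λ} (hIJ : Γ.Adj I J) (g : G I) (h : G J) :
    vertexAct Γ I g * vertexAct Γ J h = vertexAct Γ J h * vertexAct Γ I g := by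
  funext w
  apply Subtype.ext
  change cons Γ (g * head Γ I (cons Γ _ _)) (Word.tail Γ I (cons Γ _ _)) =
    cons Γ (h * head Γ J (cons Γ _ _)) (Word.tail Γ J (cons Γ _ _))
  rw [head_cons_adj Γ hIJ, head_cons_adj Γ hIJ.symm, tail_cons_adj Γ hIJ,
    tail_cons_adj Γ hIJ.symm, head_tail_adj Γ hIJ, head_tail_adj Γ hIJ.symm,
    cons_cons_adj Γ hIJ, tail_tail_adj Γ hIJ w.2]

/-- The action of the graph product on the reduced words. -/
noncomputable def act : GraphProduct Γ G →* Function.End (Red Γ G) :=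
  QuotientGroup.lift _ (Monoid.CoprodI.lift (vertexAct Γ)) <| by
    refine Subgroup.normalClosure_le_normal ?_
    rintro _ ⟨I, J, a, b, hIJ, rfl⟩
    change Monoid.CoprodI.lift (vertexAct Γ) _ = 1
    rw [← map_inv (Monoid.CoprodI.of (M := G) (i := I)),
      ← map_inv (Monoid.CoprodI.of (M := G) (i := J))]
    simp only [map_mul, Monoid.CoprodI.lift_of]
    rw [vertexAct_comm Γ hIJ, mul_assoc (vertexAct Γ J b), ← map_mul, mul_inv_cancel, map_one,
      mul_one, ← map_mul, mul_inv_cancel, map_one]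

lemma act_incl (I : Λ) (g : G I) : act Γ (incl Γ I g) = vertexAct Γ I g :=
  Monoid.CoprodI.lift_of (vertexAct Γ) g

end Word

/-! ### Normal forms and components of elements -/

/-- The reduced word of an element of the graph product. -/
noncomputable def toWord (x : GraphProduct Γ G) : Word Γ G :=
  (Word.act Γ x ⟨Word.mk Γ [], trivial⟩).1

lemma toWord_reduced (x : GraphProduct Γ G) : (toWord Γ x).Reduced :=
  (Word.act Γ x ⟨Word.mk Γ [], trivial⟩).2

lemma toWord_one : toWord Γ (1 : GraphProduct Γ G) = Word.mk Γ [] := by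
  simp [toWord]; rfl

lemma toWord_incl_mul {I : Λ} (g : G I) (x : GraphProduct Γ G) :
    toWord Γ (incl Γ I g * x) =
      Word.cons Γ (g * Word.head Γ I (toWord Γ x)) (Word.tail Γ I (toWord Γ x)) := by
  simp only [toWord, map_mul, Word.act_incl]; rfl

/-- The component `x_I` of an element of the graph product. -/
noncomputable def component (I : Λ) (x : GraphProduct Γ G) : G I := Word.head Γ I (toWord Γ x)

lemma component_one (I : Λ) : component Γ I (1 : GraphProduct Γ G) = 1 := by
  rw [component, toWord_one]; rfl

lemma component_incl_mul {I : Λ} (g : G I) (x : GraphProduct Γ G) :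
    component Γ I (incl Γ I g * x) = g * component Γ I x := by
  rw [component, toWord_incl_mul, Word.head_cons_same Γ _ ((toWord_reduced Γ x).head_tail Γ I)]
  rfl

lemma component_incl_mul_adj {I J : Λ} (hIJ : Γ.Adj I J) (g : G J) (x : GraphProduct Γ G) :
    component Γ I (incl Γ J g * x) = component Γ I x := by
  rw [component, toWord_incl_mul, Word.head_cons_adj Γ hIJ, Word.head_tail_adj Γ hIJ]
  rfl

lemma component_incl (I : Λ) (g : G I) : component Γ I (incl Γ I g) = g := by
  simpa [component_one] using component_incl_mul Γ g 1

lemma adj_of_component_ne_one {I J : Λ} (hIJ : I ≠ J) {x : GraphProduct Γ G}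
    (hI : component Γ I x ≠ 1) (hJ : component Γ J x ≠ 1) : Γ.Adj I J := by
  unfold component at hI hJ
  generalize toWord Γ x = w at hI hJ
  induction w using Quot.ind with
  | mk X => exact adj_of_syllHead_ne_one Γ hIJ hI hJ

@[simp] lemma value_nil : value Γ ([] : List (Gen G)) = 1 := rfl

@[simp] lemma value_cons (s : Gen G) (X : List (Gen G)) :
    value Γ (s :: X) = incl Γ s.1.1 s.1.2 * value Γ X := rfl

lemma IsReduced.of_shuffleEquiv {X Y : List (Gen G)} (h : IsReduced Γ X)
    (hXY : ShuffleEquiv Γ X Y) : IsReduced Γ Y :=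
  fun Z hZ => h Z (hXY.trans hZ)

lemma IsReduced.of_cons {s : Gen G} {X : List (Gen G)} (h : IsReduced Γ (s :: X)) :
    IsReduced Γ X := by
  rintro Y hY ⟨A, B, a, b, rfl, hab⟩
  exact h _ (hY.cons Γ s) ⟨s :: A, B, a, b, rfl, hab⟩

lemma IsReduced.recReduced {X : List (Gen G)} (h : IsReduced Γ X) : RecReduced Γ X := by
  induction X with
  | nil => trivial
  | cons s X ih =>
    refine ⟨?_, ih (h.of_cons Γ)⟩
    by_contra h1
    -- A nontrivial head of `X` at the vertex of `s` can be shuffled next to `s`, giving an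
    -- amalgamation.
    have h2 := (shuffleEquiv_syllCons Γ s.1.1 X).cons Γ s
    rw [syllCons_of_ne h1] at h2
    exact h _ h2 ⟨[], _, _, _, rfl, rfl⟩

/-- In a reduced expression each syllable acts on a word with trivial head at its vertex, so it is
merely prepended. Reduced expressions for one element therefore have the same class, which makes all
notions read off from them independent of choices. -/
lemma toWord_value {X : List (Gen G)} (h : RecReduced Γ X) :
    toWord Γ (value Γ X) = Word.mk Γ X := by
  induction X with
  | nil => exact toWord_one Γ
  | cons s X ih =>
    have h1 : Word.head Γ s.1.1 (Word.mk Γ X) = 1 := h.1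
    have h2 : Word.tail Γ s.1.1 (Word.mk Γ X) = Word.mk Γ X :=
      congrArg (Word.mk Γ) (syllTail_eq_self Γ h.1)
    rw [value_cons, toWord_incl_mul, ih h.2, h1, h2, mul_one]
    exact congrArg (Word.mk Γ) (syllCons_of_ne s.2 X)

lemma IsReducedFor.toWord_eq {X : List (Gen G)} {x : GraphProduct Γ G}
    (h : IsReducedFor Γ X x) : toWord Γ x = Word.mk Γ X := by
  rw [← h.2, toWord_value Γ (h.1.recReduced Γ)]

lemma IsReducedFor.component_eq {X : List (Gen G)} {x : GraphProduct Γ G}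
    (h : IsReducedFor Γ X x) (I : Λ) : component Γ I x = syllHead Γ I X := by
  rw [component, h.toWord_eq]; rfl

lemma IsInitialSyllable.syllHead_eq {X : List (Gen G)} {s : Gen G}
    (h : IsInitialSyllable Γ X s) : syllHead Γ s.1.1 X = s.1.2 := by
  obtain ⟨A, B, rfl, h⟩ := h
  induction A with
  | nil => exact syllHead_cons_self Γ s B
  | cons a A ih =>
    rw [List.forall_mem_cons] at h
    exact (syllHead_cons_adj Γ (I := s.1.1) h.1 _).trans (ih h.2)

lemma isInitialSyllable_syllHead {X : List (Gen G)} {I : Λ} (h : syllHead Γ I X ≠ 1) :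
    IsInitialSyllable Γ X ⟨⟨I, syllHead Γ I X⟩, h⟩ := by
  induction X with
  | nil => exact absurd rfl h
  | cons s X ih =>
    by_cases hs : s.1.1 = I
    · subst hs
      refine ⟨[], X, ?_, by simp⟩
      simp [syllHead_cons_self]
    · by_cases ha : Γ.Adj I s.1.1
      · simp only [syllHead_cons_adj Γ ha] at h ⊢
        obtain ⟨A, B, hX, hA⟩ := ih h
        exact ⟨s :: A, B, by rw [List.cons_append, ← hX], List.forall_mem_cons.2 ⟨ha, hA⟩⟩
      · exact absurd (syllHead_cons_of_not_adj Γ ha hs X) h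

lemma IsComponent.eq_component {I : Λ} {x : GraphProduct Γ G} {g : G I}
    (h : IsComponent Γ I x g) : g = component Γ I x := by
  obtain ⟨X, hX, ⟨h1, h2⟩ | ⟨rfl, h2⟩⟩ := h
  · rw [hX.component_eq]
    exact (h2.syllHead_eq Γ).symm
  · rw [hX.component_eq]
    by_contra h3
    exact h2 _ (isInitialSyllable_syllHead Γ (Ne.symm h3)) rfl

lemma component_ne_one_of_mem_initialVertices {I : Λ} {x : GraphProduct Γ G}
    (h : I ∈ initialVertices Γ x) : component Γ I x ≠ 1 := by
  obtain ⟨X, hX, s, hs, rfl⟩ := h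
  rw [hX.component_eq]
  exact (hs.syllHead_eq Γ).trans_ne s.2

lemma exists_mem_initialVertices {x : GraphProduct Γ G} (hx : x ≠ 1) :
    ∃ I, I ∈ initialVertices Γ x := by
  obtain ⟨X, hX⟩ := exists_reduced Γ x
  cases X with
  | nil => exact absurd hX.2.symm hx
  | cons s X => exact ⟨s.1.1, s :: X, hX, s, ⟨[], X, rfl, by simp⟩, rfl⟩

lemma len_component_inv_mul_lt {I : Λ} {x : GraphProduct Γ G} (h : component Γ I x ≠ 1) :
    len Γ ((incl Γ I (component Γ I x))⁻¹ * x) < len Γ x := by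
  have hne : {n | ∃ X : List (Gen G), IsReducedFor Γ X x ∧ X.length = n}.Nonempty := by
    obtain ⟨X, hX⟩ := exists_reduced Γ x
    exact ⟨_, X, hX, rfl⟩
  -- The length is an infimum over reduced expressions, so it is enough to strip the head from one
  -- that attains it.
  obtain ⟨X, hX, hl⟩ := Nat.sInf_mem hne
  have h1 := shuffleEquiv_syllCons Γ I X
  rw [hX.component_eq] at h ⊢
  rw [syllCons_of_ne h] at h1
  obtain ⟨h2, h3⟩ := shuffle_value Γ h1
  rw [List.length_cons] at h3
  have h4 : len Γ ((incl Γ I (syllHead Γ I X))⁻¹ * x) ≤ (syllTail Γ I X).length := by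
    refine Nat.sInf_le ⟨_, ⟨(hX.1.of_shuffleEquiv Γ h1).of_cons Γ, ?_⟩, rfl⟩
    rw [← hX.2, h2, value_cons, inv_mul_cancel_left]
  change _ < sInf _
  omega

end Words

end QLGraph
namespace QLGraph

/-! ### Positivity, commutation and retractions -/

section Cone

variable {Λ : Type*} (Γ : SimpleGraph Λ) {G : Λ → Type*} [∀ I, Group (G I)]
  {P : ∀ I, Submonoid (G I)}

lemma incl_mem_cone {I : Λ} {g : G I} (hg : g ∈ P I) : incl Γ I g ∈ cone Γ P :=
  le_iSup (fun I => (P I).map (incl Γ I)) I ⟨g, hg, rfl⟩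

lemma value_mem_cone {X : List (Gen G)} (h : ∀ s ∈ X, s.1.2 ∈ P s.1.1) :
    value Γ X ∈ cone Γ P := by
  induction X with
  | nil => exact one_mem _
  | cons s X ih =>
    rw [List.forall_mem_cons] at h
    exact mul_mem (incl_mem_cone Γ h.1) (ih h.2)

variable (P) in
/-- The elements whose action preserves positivity of reduced words. -/
def positiveActing : Submonoid (GraphProduct Γ G) where
  carrier := {x | ∀ w : Word.Red Γ G, w.1.Positive Γ P → (Word.act Γ x w).1.Positive Γ P}
  one_mem' w hw := by rwa [map_one]
  mul_mem' {x y} hx hy w hw := by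
    rw [map_mul]
    exact hx _ (hy w hw)

/-- A generator of the cone replaces a head in `P I` by a product in `P I` and leaves the other
syllables alone. -/
lemma cone_le_positiveActing : cone Γ P ≤ positiveActing Γ P := by
  refine iSup_le fun I => ?_
  rintro _ ⟨g, hg, rfl⟩ w hw
  rw [Word.act_incl]
  exact (hw.tail Γ I).cons Γ (mul_mem hg (hw.head Γ I))

lemma toWord_positive {x : GraphProduct Γ G} (hx : x ∈ cone Γ P) :
    (toWord Γ x).Positive Γ P :=
  cone_le_positiveActing Γ hx ⟨Word.mk Γ [], trivial⟩
    (show ∀ s ∈ ([] : List (Gen G)), s.1.2 ∈ P s.1.1 by simp)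

lemma IsReducedFor.forall_mem {X : List (Gen G)} {x : GraphProduct Γ G}
    (h : IsReducedFor Γ X x) (hx : x ∈ cone Γ P) : ∀ s ∈ X, s.1.2 ∈ P s.1.1 := by
  have h1 := toWord_positive Γ hx
  rwa [h.toWord_eq] at h1

lemma component_mem {x : GraphProduct Γ G} (hx : x ∈ cone Γ P) (I : Λ) :
    component Γ I x ∈ P I := (toWord_positive Γ hx).head Γ I

/-- The element `x'` in the decomposition `x = x_I x'`. -/
noncomputable def rest (I : Λ) (x : GraphProduct Γ G) : GraphProduct Γ G :=
  (incl Γ I (component Γ I x))⁻¹ * x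

lemma incl_component_mul_rest (I : Λ) (x : GraphProduct Γ G) :
    incl Γ I (component Γ I x) * rest Γ I x = x := mul_inv_cancel_left _ _

lemma component_rest (I : Λ) (x : GraphProduct Γ G) : component Γ I (rest Γ I x) = 1 := by
  rw [rest, ← map_inv, component_incl_mul, inv_mul_cancel]

lemma rest_mem {x : GraphProduct Γ G} (hx : x ∈ cone Γ P) (I : Λ) : rest Γ I x ∈ cone Γ P := by
  obtain ⟨X, hX⟩ := exists_reduced Γ x
  have h1 : (Word.mk Γ X).Positive Γ P := hX.forall_mem Γ hx
  have h2 := (shuffle_value Γ (shuffleEquiv_syllCons Γ I X)).1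
  have h3 : value Γ (syllCons (syllHead Γ I X) (syllTail Γ I X)) =
      incl Γ I (syllHead Γ I X) * value Γ (syllTail Γ I X) := by
    by_cases h : syllHead Γ I X = 1
    · simp [h]
    · rw [syllCons_of_ne h, value_cons]
  rw [rest, hX.component_eq, ← hX.2, h2, h3, inv_mul_cancel_left]
  exact value_mem_cone Γ (h1.tail Γ I)

lemma IsDecomposition.eq {I : Λ} {x x' : GraphProduct Γ G} {g : G I}
    (h : IsDecomposition Γ I x g x') : g = component Γ I x ∧ x' = rest Γ I x := by
  have h1 := h.1.eq_component Γ
  refine ⟨h1, ?_⟩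
  rw [rest, ← h1, eq_inv_mul_iff_mul_eq, ← h.2]

lemma len_rest_le (I : Λ) (x : GraphProduct Γ G) : len Γ (rest Γ I x) ≤ len Γ x := by
  by_cases h : component Γ I x = 1
  · rw [rest, h, map_one, inv_one, one_mul]
  · exact (len_component_inv_mul_lt Γ h).le

lemma len_rest_add_lt {I : Λ} {x y : GraphProduct Γ G}
    (h : I ∈ initialVertices Γ x ∪ initialVertices Γ y) :
    len Γ (rest Γ I x) + len Γ (rest Γ I y) < len Γ x + len Γ y := by
  rcases h with h | h
  · exact add_lt_add_of_lt_of_le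
      (len_component_inv_mul_lt Γ (component_ne_one_of_mem_initialVertices Γ h))
      (len_rest_le Γ I y)
  · exact add_lt_add_of_le_of_lt (len_rest_le Γ I x)
      (len_component_inv_mul_lt Γ (component_ne_one_of_mem_initialVertices Γ h))

section Commuting

variable {I : Λ} {u : GraphProduct Γ G} (hu : ∀ J ∈ vertices Γ u, Γ.Adj I J)
include hu

lemma commute_of_vertices_adj (g : G I) : incl Γ I g * u = u * incl Γ I g := by
  obtain ⟨X, hX⟩ := exists_reduced Γ u
  have h : ∀ s ∈ X, Γ.Adj I s.1.1 := fun s hs => hu _ ⟨X, hX, s, hs, rfl⟩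
  rw [← hX.2]
  clear hX
  induction X with
  | nil => simp
  | cons s X ih =>
    rw [List.forall_mem_cons] at h
    rw [value_cons, ← mul_assoc, incl_comm Γ h.1, mul_assoc, ih h.2, mul_assoc]

lemma component_mul_of_vertices_adj (w : GraphProduct Γ G) :
    component Γ I (u * w) = component Γ I w := by
  obtain ⟨X, hX⟩ := exists_reduced Γ u
  have h : ∀ s ∈ X, Γ.Adj I s.1.1 := fun s hs => hu _ ⟨X, hX, s, hs, rfl⟩
  rw [← hX.2]
  clear hX
  induction X with
  | nil => simp
  | cons s X ih =>
    rw [List.forall_mem_cons] at h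
    rw [value_cons, mul_assoc, component_incl_mul_adj Γ h.1, ih h.2]

end Commuting

open Classical in
/-- The endomorphism killing the vertex groups outside `S`. -/
noncomputable def restrictTo (S : Set Λ) : GraphProduct Γ G →* GraphProduct Γ G :=
  QuotientGroup.lift _ (Monoid.CoprodI.lift fun I => if I ∈ S then incl Γ I else 1) <| by
    refine Subgroup.normalClosure_le_normal ?_
    rintro _ ⟨I, J, a, b, hIJ, rfl⟩
    change Monoid.CoprodI.lift _ _ = 1
    simp only [map_mul, map_inv, Monoid.CoprodI.lift_of]
    rw [mul_inv_eq_one, mul_inv_eq_iff_eq_mul]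
    split_ifs
    · exact incl_comm Γ hIJ a b
    all_goals simp

open Classical in
lemma restrictTo_incl_of_mem {S : Set Λ} {I : Λ} (h : I ∈ S) (g : G I) :
    restrictTo Γ S (incl Γ I g) = incl Γ I g := by
  refine (Monoid.CoprodI.lift_of
    (fun I => if I ∈ S then incl Γ I else (1 : G I →* GraphProduct Γ G)) g).trans ?_
  rw [if_pos h]

open Classical in
lemma restrictTo_incl_of_notMem {S : Set Λ} {I : Λ} (h : I ∉ S) (g : G I) :
    restrictTo Γ S (incl Γ I g) = 1 := by
  refine (Monoid.CoprodI.lift_of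
    (fun I => if I ∈ S then incl Γ I else (1 : G I →* GraphProduct Γ G)) g).trans ?_
  rw [if_neg h, MonoidHom.one_apply]

lemma restrictTo_compl_restrictTo (S : Set Λ) (x : GraphProduct Γ G) :
    restrictTo Γ Sᶜ (restrictTo Γ S x) = 1 := by
  obtain ⟨X, rfl⟩ := exists_expr Γ x
  induction X with
  | nil => simp
  | cons s X ih =>
    rw [value_cons, map_mul, map_mul, ih, mul_one]
    by_cases h : s.1.1 ∈ S
    · rw [restrictTo_incl_of_mem Γ h, restrictTo_incl_of_notMem Γ (by simpa using h)]
    · rw [restrictTo_incl_of_notMem Γ h, map_one]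

lemma restrictTo_eq_self {S : Set Λ} {x : GraphProduct Γ G} (h : vertices Γ x ⊆ S) :
    restrictTo Γ S x = x := by
  obtain ⟨X, hX⟩ := exists_reduced Γ x
  have h : ∀ s ∈ X, s.1.1 ∈ S := fun s hs => h ⟨X, hX, s, hs, rfl⟩
  rw [← hX.2]
  clear hX
  induction X with
  | nil => simp
  | cons s X ih =>
    rw [List.forall_mem_cons] at h
    rw [value_cons, map_mul, ih h.2, restrictTo_incl_of_mem Γ h.1]

lemma restrictTo_mem (S : Set Λ) {x : GraphProduct Γ G} (hx : x ∈ cone Γ P) :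
    restrictTo Γ S x ∈ cone Γ P := by
  refine (show cone Γ P ≤ (cone Γ P).comap (restrictTo Γ S) from iSup_le fun I => ?_) hx
  rintro _ ⟨g, hg, rfl⟩
  change restrictTo Γ S (incl Γ I g) ∈ cone Γ P
  by_cases h : I ∈ S
  · rw [restrictTo_incl_of_mem Γ h]
    exact incl_mem_cone Γ hg
  · rw [restrictTo_incl_of_notMem Γ h]
    exact one_mem _

end Cone

/-! ### Antisymmetry and uniqueness of joins -/

section QuasiLattice

variable {H : Type*} [Group H] {Q : Submonoid H}

lemma IsQuasiLattice.eq_one_of_mul_eq_one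
    (hQ : ∀ x, x ∈ Q → x⁻¹ ∈ Q → x = 1) {x y : H} (hx : x ∈ Q) (hy : y ∈ Q)
    (h : x * y = 1) : x = 1 :=
  hQ x hx (by rwa [inv_eq_of_mul_eq_one_right h])

lemma ConeLE.antisymm (hQ : ∀ x, x ∈ Q → x⁻¹ ∈ Q → x = 1) {x y : H}
    (h1 : ConeLE Q x y) (h2 : ConeLE Q y x) : x = y := by
  have := hQ _ h1 (by simpa [ConeLE] using h2)
  rwa [inv_mul_eq_one] at this

lemma IsJoin.isJoin_iff (hQ : ∀ x, x ∈ Q → x⁻¹ ∈ Q → x = 1) {x y z w : H}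
    (h : IsJoin Q x y z) : IsJoin Q x y w ↔ w = z := by
  refine ⟨fun h' => ?_, by rintro rfl; exact h⟩
  exact (h'.2 z h.1).antisymm hQ (h.2 w h'.1)

end QuasiLattice

/-! ### Upper bounds and joins in the graph product -/

section Join

variable {Λ : Type*} (Γ : SimpleGraph Λ) {G : Λ → Type*} [∀ I, Group (G I)]
  {P : ∀ I, Submonoid (G I)} (hP : ∀ I, IsQuasiLattice (P I))

/-- With a = x_I p, the quotient is x'⁻¹ p b. Either p = 1, or p commutes with x' and the quotient
is p (x'⁻¹ b). -/
lemma coneLE_incl_mul (I : Λ) {x b : GraphProduct Γ G} {a : G I}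
    (ha : ConeLE (P I) (component Γ I x) a) (hb : ConeLE (cone Γ P) (rest Γ I x) b)
    (h : component Γ I x = a ∨ ∀ J ∈ vertices Γ (rest Γ I x), Γ.Adj I J) :
    ConeLE (cone Γ P) x (incl Γ I a * b) := by
  obtain ⟨p, hp, rfl⟩ : ∃ p ∈ P I, a = component Γ I x * p := ⟨_, ha, by simp⟩
  have h1 : x⁻¹ * (incl Γ I (component Γ I x * p) * b) =
      (rest Γ I x)⁻¹ * incl Γ I p * b := by
    conv_lhs => rw [← incl_component_mul_rest Γ I x, component_incl_mul, component_rest, mul_one]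
    simp [mul_assoc]
  rw [ConeLE, h1]
  rcases h with h | h
  · rw [left_eq_mul] at h
    rw [h, map_one, mul_one]
    exact hb
  · have h2 : (rest Γ I x)⁻¹ * incl Γ I p = incl Γ I p * (rest Γ I x)⁻¹ := by
      rw [inv_mul_eq_iff_eq_mul, ← mul_assoc, ← commute_of_vertices_adj Γ h, mul_inv_cancel_right]
    rw [h2, mul_assoc]
    exact mul_mem (incl_mem_cone Γ hp) hb

include hP

/-- At an initial vertex I of x, the component of x x⁻¹ = 1 is x_I (x' x⁻¹)_I, a product of two
elements of the pointed cone `P I`. -/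
lemma cone_pointed (x : GraphProduct Γ G) (hx : x ∈ cone Γ P) (hx' : x⁻¹ ∈ cone Γ P) :
    x = 1 := by
  by_contra h
  obtain ⟨I, hI⟩ := exists_mem_initialVertices Γ h
  apply component_ne_one_of_mem_initialVertices Γ hI
  refine IsQuasiLattice.eq_one_of_mul_eq_one (hP I).pointed (component_mem Γ hx I)
    (component_mem Γ (mul_mem (rest_mem Γ hx I) hx') I) ?_
  rw [← component_incl_mul, ← mul_assoc, incl_component_mul_rest, mul_inv_cancel, component_one]

/-- A new initial syllable of a product of positive elements commutes past the first factor. -/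
lemma vertices_adj_of_component_mul_ne_one {I : Λ} {u w : GraphProduct Γ G}
    (hu : u ∈ cone Γ P) (hw : w ∈ cone Γ P) (h1 : component Γ I u = 1)
    (h2 : component Γ I (u * w) ≠ 1) : ∀ J ∈ vertices Γ u, Γ.Adj I J := by
  rintro _ ⟨X, hX, s, hs, rfl⟩
  have hpos := hX.forall_mem Γ hu
  rw [hX.component_eq] at h1
  obtain ⟨-, rfl⟩ := hX
  clear hu
  induction X with
  | nil => simp at hs
  | cons t X ih =>
    rw [List.forall_mem_cons] at hpos
    have ht : t.1.1 ≠ I := by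
      rintro rfl
      rw [syllHead_cons_self] at h1
      exact t.2 h1
    have hXw := mul_mem (value_mem_cone Γ hpos.2) hw
    have hadj : Γ.Adj I t.1.1 := by
      -- The syllable `t` survives in the product: the component at its vertex is `t` times an
      -- element of the same vertex cone, hence nontrivial. Distinct initial vertices are adjacent.
      refine adj_of_component_ne_one Γ ht.symm h2 fun h3 => t.2 ?_
      rw [value_cons, mul_assoc, component_incl_mul] at h3
      exact IsQuasiLattice.eq_one_of_mul_eq_one (hP _).pointed hpos.1 (component_mem Γ hXw _) h3
    rw [value_cons, mul_assoc, component_incl_mul_adj Γ hadj] at h2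
    rw [syllHead_cons_adj Γ hadj] at h1
    rcases List.mem_cons.1 hs with rfl | hs
    · exact hadj
    · exact ih h1 hs hpos.2 h2

/-- For z = xw, one has z_I = x_I q with q the component of x'w at I. If q = 1, then z' = x'w.
Otherwise I is adjacent to the vertices of x', so q is the component of w, and it commutes past x'
to give z' = x'w'. -/
lemma coneLE_component_rest (I : Λ) {x z : GraphProduct Γ G} (hx : x ∈ cone Γ P)
    (hxz : ConeLE (cone Γ P) x z) :
    ConeLE (P I) (component Γ I x) (component Γ I z) ∧
      (component Γ I x = component Γ I z ∨ ∀ J ∈ vertices Γ (rest Γ I x), Γ.Adj I J) ∧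
      ConeLE (cone Γ P) (rest Γ I x) (rest Γ I z) := by
  have hxw := rest_mem Γ hx I
  have h1 := component_rest Γ I x
  obtain ⟨w, hw, rfl⟩ : ∃ w ∈ cone Γ P, z = x * w := ⟨_, hxz, by simp⟩
  have hz : x * w = incl Γ I (component Γ I x) * (rest Γ I x * w) := by
    rw [← mul_assoc, incl_component_mul_rest]
  have hc : component Γ I (x * w) = component Γ I x * component Γ I (rest Γ I x * w) := by
    rw [hz, component_incl_mul]
  have hr : rest Γ I (x * w) =
      (incl Γ I (component Γ I (rest Γ I x * w)))⁻¹ * (rest Γ I x * w) := by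
    rw [rest, hc, map_mul, hz, mul_inv_rev, mul_assoc, inv_mul_cancel_left]
  simp only [ConeLE]
  rw [hr, hc, inv_mul_cancel_left]
  refine ⟨component_mem Γ (mul_mem hxw hw) I, ?_⟩
  by_cases h2 : component Γ I (rest Γ I x * w) = 1
  · rw [h2]
    simpa using hw
  · have h3 := vertices_adj_of_component_mul_ne_one Γ hP hxw hw h1 h2
    refine ⟨Or.inr h3, ?_⟩
    rw [component_mul_of_vertices_adj Γ h3, ← map_inv, ← mul_assoc (incl Γ I _),
      commute_of_vertices_adj Γ h3, mul_assoc, inv_mul_cancel_left, map_inv]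
    exact rest_mem Γ hw I

/-- The retraction r onto the vertices in `S` fixes x and y, so r(z) is an upper bound and z ≤ r(z).
The complementary retraction kills r(z), hence by pointedness it also kills z and each positive
syllable of z. -/
lemma vertices_subset_of_isJoin {S : Set Λ} {x y z : GraphProduct Γ G}
    (hx : x ∈ cone Γ P) (h : IsJoin (cone Γ P) x y z)
    (hxS : vertices Γ x ⊆ S) (hyS : vertices Γ y ⊆ S) : vertices Γ z ⊆ S := by
  have hz : z ∈ cone Γ P := by simpa [ConeLE] using mul_mem hx h.1.1
  have h1 : ConeLE (cone Γ P) z (restrictTo Γ S z) := by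
    refine h.2 _ ⟨?_, ?_⟩
    · simpa [ConeLE, restrictTo_eq_self Γ hxS] using restrictTo_mem Γ S h.1.1
    · simpa [ConeLE, restrictTo_eq_self Γ hyS] using restrictTo_mem Γ S h.1.2
  have h2 : restrictTo Γ Sᶜ z = 1 := by
    refine IsQuasiLattice.eq_one_of_mul_eq_one (cone_pointed Γ hP) (restrictTo_mem Γ Sᶜ hz)
      (restrictTo_mem Γ Sᶜ h1) ?_
    rw [← map_mul, mul_inv_cancel_left, restrictTo_compl_restrictTo]
  rintro _ ⟨X, hX, s, hs, rfl⟩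
  have hpos := hX.forall_mem Γ hz
  rw [← hX.2] at h2
  clear hX
  induction X with
  | nil => simp at hs
  | cons t X ih =>
    rw [List.forall_mem_cons] at hpos
    rw [value_cons, map_mul] at h2
    have h3 := IsQuasiLattice.eq_one_of_mul_eq_one (cone_pointed Γ hP)
      (restrictTo_mem Γ Sᶜ (incl_mem_cone Γ hpos.1))
      (restrictTo_mem Γ Sᶜ (value_mem_cone Γ hpos.2)) h2
    rcases List.mem_cons.1 hs with rfl | hs
    · by_contra h4
      rw [restrictTo_incl_of_mem Γ h4] at h3
      apply s.2
      rw [← component_incl Γ s.1.1 s.1.2, h3, component_one]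
    · rw [h3, one_mul] at h2
      exact ih h2 hs hpos.2

lemma isUpper_incl_mul (I : Λ) {x y b : GraphProduct Γ G} {a : G I}
    (ha : IsJoin (P I) (component Γ I x) (component Γ I y) a)
    (hb : IsUpper (cone Γ P) (rest Γ I x) (rest Γ I y) b)
    (h : IAdjacent Γ P I (component Γ I x) (rest Γ I x) (component Γ I y) (rest Γ I y)) :
    IsUpper (cone Γ P) x y (incl Γ I a * b) :=
  ⟨coneLE_incl_mul Γ I ha.1.1 hb.1 (h.left.imp_left (ha.isJoin_iff (hP I).pointed).1),
    coneLE_incl_mul Γ I ha.1.2 hb.2 (h.right.imp_left (ha.isJoin_iff (hP I).pointed).1)⟩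

lemma isUpper_component_rest (I : Λ) {x y z : GraphProduct Γ G} (hx : x ∈ cone Γ P)
    (hy : y ∈ cone Γ P) (h : IsUpper (cone Γ P) x y z) :
    IAdjacent Γ P I (component Γ I x) (rest Γ I x) (component Γ I y) (rest Γ I y) ∧
      IsUpper (P I) (component Γ I x) (component Γ I y) (component Γ I z) ∧
      IsUpper (cone Γ P) (rest Γ I x) (rest Γ I y) (rest Γ I z) := by
  obtain ⟨h1, h2, h3⟩ := coneLE_component_rest Γ hP I hx h.1
  obtain ⟨k1, k2, k3⟩ := coneLE_component_rest Γ hP I hy h.2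
  obtain ⟨a, ha⟩ := (hP I).exists_join _ _ ⟨_, h1, k1⟩
  have haz := ha.2 _ ⟨h1, k1⟩
  refine ⟨⟨⟨_, h1, k1⟩, h2.imp_left fun e => ?_, k2.imp_left fun e => ?_⟩, ⟨h1, k1⟩, h3, k3⟩
  · rw [ha.isJoin_iff (hP I).pointed]
    -- If x_I = z_I, then a ≤ z_I = x_I ≤ a.
    exact ha.1.1.antisymm (hP I).pointed (e ▸ haz)
  · rw [ha.isJoin_iff (hP I).pointed]
    exact ha.1.2.antisymm (hP I).pointed (e ▸ haz)

lemma isJoin_incl_mul (I : Λ) {x y b : GraphProduct Γ G} {a : G I} (hx : x ∈ cone Γ P)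
    (hy : y ∈ cone Γ P) (h : Bounded (cone Γ P) x y)
    (ha : IsJoin (P I) (component Γ I x) (component Γ I y) a)
    (hb : IsJoin (cone Γ P) (rest Γ I x) (rest Γ I y) b) :
    IsJoin (cone Γ P) x y (incl Γ I a * b) := by
  obtain ⟨w, hw⟩ := h
  refine ⟨isUpper_incl_mul Γ hP I ha hb.1 (isUpper_component_rest Γ hP I hx hy hw).1, ?_⟩
  intro z hz
  obtain ⟨-, h1, h2⟩ := isUpper_component_rest Γ hP I hx hy hz
  have h3 := ha.2 _ h1
  have h4 := hb.2 _ h2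
  obtain ⟨p, hp, hpz⟩ : ∃ p ∈ P I, component Γ I z = a * p := ⟨_, h3, by simp⟩
  have h5 : (incl Γ I a * b)⁻¹ * z = b⁻¹ * incl Γ I p * rest Γ I z := by
    conv_lhs => rw [← incl_component_mul_rest Γ I z, hpz]
    simp [mul_assoc]
  rw [ConeLE, h5]
  by_cases hp1 : p = 1
  · rw [hp1, map_one, mul_one]
    exact h4
  -- Since x_I, y_I ≤ a < z_I, neither equals z_I, which forces the adjacency alternative for both x
  -- and y.
  · have hne : a ≠ component Γ I z := fun e => hp1 (by rwa [← e, left_eq_mul] at hpz)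
    have hxv := (coneLE_component_rest Γ hP I hx hz.1).2.1.resolve_left fun e =>
      hne (h3.antisymm (hP I).pointed (e ▸ ha.1.1))
    have hyv := (coneLE_component_rest Γ hP I hy hz.2).2.1.resolve_left fun e =>
      hne (h3.antisymm (hP I).pointed (e ▸ ha.1.2))
    have hbv := vertices_subset_of_isJoin Γ hP (S := {J | Γ.Adj I J}) (rest_mem Γ hx I) hb hxv hyv
    have h6 : b⁻¹ * incl Γ I p = incl Γ I p * b⁻¹ := by
      rw [inv_mul_eq_iff_eq_mul, ← mul_assoc, ← commute_of_vertices_adj Γ hbv,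
        mul_inv_cancel_right]
    rw [h6, mul_assoc]
    exact mul_mem (incl_mem_cone Γ hp) h4

lemma cone_exists_isJoin {x y : GraphProduct Γ G} (hx : x ∈ cone Γ P) (hy : y ∈ cone Γ P)
    (h : Bounded (cone Γ P) x y) : ∃ z, IsJoin (cone Γ P) x y z := by
  induction hn : len Γ x + len Γ y using Nat.strong_induction_on generalizing x y with
  | _ n ih =>
    by_cases hI : (initialVertices Γ x ∪ initialVertices Γ y).Nonempty
    · obtain ⟨I, hI⟩ := hI
      obtain ⟨z, hz⟩ := h
      obtain ⟨-, h1, h2⟩ := isUpper_component_rest Γ hP I hx hy hz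
      obtain ⟨a, ha⟩ := (hP I).exists_join _ _ ⟨_, h1⟩
      -- Splitting at an initial vertex of x or y lowers the total length, so the rests have a join
      -- by induction.
      obtain ⟨b, hb⟩ := ih _ (hn ▸ len_rest_add_lt Γ hI) (rest_mem Γ hx I) (rest_mem Γ hy I)
        ⟨_, h2⟩ rfl
      exact ⟨_, isJoin_incl_mul Γ hP I hx hy ⟨z, hz⟩ ha hb⟩
    · have hx1 : x = 1 := by
        by_contra h1
        exact hI ((exists_mem_initialVertices Γ h1).imp fun _ => Or.inl)
      have hy1 : y = 1 := by
        by_contra h1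
        exact hI ((exists_mem_initialVertices Γ h1).imp fun _ => Or.inr)
      subst hx1 hy1
      exact ⟨1, by simp [IsUpper, ConeLE], fun w hw => hw.1⟩

end Join

end QLGraph

theorem mainTheorem2 {Λ : Type*} (Γ : SimpleGraph Λ) (G : Λ → Type*) [∀ I, Group (G I)]
    (P : ∀ I, Submonoid (G I)) (hP : ∀ I, QLGraph.IsQuasiLattice (P I))
    (x y : QLGraph.GraphProduct Γ G)
    (hx : x ∈ QLGraph.cone Γ P) (hy : y ∈ QLGraph.cone Γ P) :
    (∀ (I : Λ) (xI yI : G I) (x' y' : QLGraph.GraphProduct Γ G),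
      QLGraph.IsDecomposition Γ I x xI x' → QLGraph.IsDecomposition Γ I y yI y' →
      (QLGraph.Bounded (QLGraph.cone Γ P) x y ↔
        QLGraph.IAdjacent Γ P I xI x' yI y' ∧ QLGraph.Bounded (QLGraph.cone Γ P) x' y') ∧
      (QLGraph.Bounded (QLGraph.cone Γ P) x y →
        ∃ (a : G I) (b : QLGraph.GraphProduct Γ G),
          QLGraph.IsJoin (P I) xI yI a ∧ QLGraph.IsJoin (QLGraph.cone Γ P) x' y' b ∧
          ∀ z, QLGraph.IsJoin (QLGraph.cone Γ P) x y z ↔ z = QLGraph.incl Γ I a * b) ∧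
      x' ∈ QLGraph.cone Γ P ∧ y' ∈ QLGraph.cone Γ P ∧
      (I ∈ QLGraph.initialVertices Γ x ∪ QLGraph.initialVertices Γ y →
        QLGraph.len Γ x' + QLGraph.len Γ y' < QLGraph.len Γ x + QLGraph.len Γ y)) ∧
    (x ≠ 1 ∨ y ≠ 1 →
      (QLGraph.initialVertices Γ x ∪ QLGraph.initialVertices Γ y).Nonempty) := by
  refine ⟨?_, ?_⟩
  · intro I xI yI x' y' hdx hdy
    -- By the normal form, every decomposition at `I` is the one given by `component` and `rest`.
    obtain ⟨rfl, rfl⟩ := hdx.eq Γ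
    obtain ⟨rfl, rfl⟩ := hdy.eq Γ
    have hx' := QLGraph.rest_mem Γ hx I
    have hy' := QLGraph.rest_mem Γ hy I
    refine ⟨⟨?_, ?_⟩, ?_, hx', hy', QLGraph.len_rest_add_lt Γ⟩
    · rintro ⟨z, hz⟩
      obtain ⟨h1, -, h2⟩ := QLGraph.isUpper_component_rest Γ hP I hx hy hz
      exact ⟨h1, _, h2⟩
    · rintro ⟨h1, b, hb⟩
      obtain ⟨a, ha⟩ := (hP I).exists_join _ _ h1.bounded
      exact ⟨_, QLGraph.isUpper_incl_mul Γ hP I ha hb h1⟩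
    · rintro ⟨z, hz⟩
      obtain ⟨-, h1, h2⟩ := QLGraph.isUpper_component_rest Γ hP I hx hy hz
      obtain ⟨a, ha⟩ := (hP I).exists_join _ _ ⟨_, h1⟩
      obtain ⟨b, hb⟩ := QLGraph.cone_exists_isJoin Γ hP hx' hy' ⟨_, h2⟩
      exact ⟨a, b, ha, hb, fun _ => (QLGraph.isJoin_incl_mul Γ hP I hx hy ⟨z, hz⟩ ha
        hb).isJoin_iff (QLGraph.cone_pointed Γ hP)⟩
  · rintro (h | h)
    · exact (QLGraph.exists_mem_initialVertices Γ h).imp fun _ => Or.inl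
    · exact (QLGraph.exists_mem_initialVertices Γ h).imp fun _ => Or.inr
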